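/- Let $N\ge 1$, $c\in(0,1)$, $b_1\le b_2\le\dots\le b_N$ real, $a_j=b_{j+1}-b_j$ $(1\le j\le N-1)$, and $\psi_j(x)=c(x+b_j)$ for $x\in\mathbb R$. Let $A\subset\mathbb R$ be the invariant set of $\Psi=\{\psi_j\}_{j=1}^N$, i.e. the nonempty compact set with $A=\bigcup_{j=1}^N\psi_j(A)$. The system $\Psi$ is said to have well-separated images if $$\min_{j\ne k} d(\psi_j(A),\psi_k(A))\ \ge\ \max_{j}\operatorname{diam}\psi_j(A),\qquad d(S,T)=\inf_{x\in S,\,y\in T}|x-y| .$$ (For $N=1$ a minimum over an empty family is $+\infty$.) For $s\in\mathbb R$ let $\check C(A,s)$ be the simplicial complex of all nonempty finite $\sigma\subseteq A$ with $\bigcap_{x\in\sigma}\overline{B(x,s/2)}\neq\emptyset$ (empty for $s<0$), and let $H_0\check{\mathcal C}(A)$ be the persistence module formed by the spaces $H_0(\check C(A,s);\mathbb Z/2)$ and the maps induced by inclusion, with the convention that the maximal death time is $\operatorname{diam}A$: the spaces with $s\ge\operatorname{diam}A$ are replaced by $0$. Writing $M^{s,t}$ for its maps, its persistence landscape is $\mathbf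 f=\{f^{(j)}\}_{j\ge1}$, $$f^{(j)}(t)=\sup\{m\ge0:\ \operatorname{rank}M^{t-m,t+m}\ge j\},\qquad \sup\emptyset=0 .$$ Then $\Psi$ has well-separated images if and only if $$\frac{2c}{1-c}(b_N-b_1)\ \le\ \min_{1\le j\le N-1}a_j .\qquad(*)$$ Moreover, if $(*)$ holds, then, with $\tau_{(0,d)}(t)=\max(0,\min(t,d-t))$, $$f^{(j)}=\begin{cases}\tau_{(0,\delta_j)} & \text{if } 1\le j\le N,\\ \tau_{(0,c^k\delta_l)} & \text{if } (l-1)N^k<j\le lN^k,\ k,l\in\mathbb N,\ k\ge 1,\ 2\le l\le N,\end{cases}$$ where $\delta_1=\frac{c}{1-c}(b_N-b_1)$ and, for $1\le k\le N-1$, $\delta_{k+1}$ is the $k$-th largest element, counted with multiplicity, of the family $c(a_l-\delta_1)$, $1\le l\le N-1$. -/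

import Mathlib

open scoped ENNReal NNReal

noncomputable section

universe u

/-! ### Iterated function systems -/

/-- `A` is the invariant set of the finite family of maps `ψ`: a nonempty compact set with
`A = ⋃ j, ψ j (A)`. -/
def IsInvariantSet {ι E : Type*} [TopologicalSpace E] (ψ : ι → E → E) (A : Set E) : Prop :=
  A.Nonempty ∧ IsCompact A ∧ A = ⋃ j, ψ j '' A

/-- The distance `inf {d(x, y) : x ∈ S, y ∈ T}` between two sets, as an extended number. -/
def setEDist {E : Type*} [PseudoEMetricSpace E] (S T : Set E) : ℝ≥0∞ :=
  ⨅ x ∈ S, ⨅ y ∈ T, edist x y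

/-- The family `ψ`, with invariant set `A`, has well-separated images:
`max_j diam ψ_j(A) ≤ min_{j ≠ k} d(ψ_j(A), ψ_k(A))`
(the minimum over the empty family is `∞`). -/
def WellSeparatedImages {ι E : Type*} [PseudoEMetricSpace E] (ψ : ι → E → E) (A : Set E) :
    Prop :=
  ⨆ j, Metric.ediam (ψ j '' A) ≤ ⨅ j, ⨅ k, ⨅ (_ : j ≠ k), setEDist (ψ j '' A) (ψ k '' A)

/-! ### Simplicial homology in degree zero, with coefficients in `ℤ/2` -/

namespace PreAbstractSimplicialComplex

variable {V : Type u}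

/-- The `p`-simplices of `K`: the faces with `p + 1` vertices. -/
def Simplex (K : PreAbstractSimplicialComplex V) (p : ℕ) : Type u :=
  {σ : Finset V // σ ∈ K.faces ∧ σ.card = p + 1}

/-- The `p`-chains of `K` with coefficients in `ℤ/2`. -/
abbrev Chain (K : PreAbstractSimplicialComplex V) (p : ℕ) : Type u :=
  K.Simplex p →₀ ZMod 2

open Classical in
/-- The face of a `(p + 1)`-simplex opposite to its vertex `x`. -/
def Simplex.face {K : PreAbstractSimplicialComplex V} {p : ℕ} (σ : K.Simplex (p + 1))
    (x : {x // x ∈ σ.1}) : K.Simplex p :=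
  ⟨σ.1.erase x.1, by
    have hcard : (σ.1.erase x.1).card = p + 1 := by
      rw [Finset.card_erase_of_mem x.2, σ.2.2, Nat.add_sub_cancel]
    refine ⟨(K.isRelLowerSet_faces σ.2.1).2 (Finset.erase_subset _ _) ?_, hcard⟩
    exact Finset.card_pos.mp (by omega)⟩

/-- The boundary map `∂ : C_{p+1} → C_p`, sending a simplex to the sum of its facets
(there are no signs over `ℤ/2`). -/
def boundary (K : PreAbstractSimplicialComplex V) (p : ℕ) :
    K.Chain (p + 1) →ₗ[ZMod 2] K.Chain p :=
  Finsupp.linearCombination (ZMod 2)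
    fun σ : K.Simplex (p + 1) => ∑ x : {x // x ∈ σ.1}, Finsupp.single (σ.face x) (1 : ZMod 2)

/-- `H_0(K; ℤ/2) = ker ∂₀ / im ∂₁`, where `∂₀ = 0`, so that every `0`-chain is a cycle. -/
abbrev H0 (K : PreAbstractSimplicialComplex V) : Type u :=
  K.Chain 0 ⧸ LinearMap.range (K.boundary 0)

/-- The inclusion of a subcomplex on `p`-simplices. -/
def Simplex.incl {K L : PreAbstractSimplicialComplex V} (h : K ≤ L) (p : ℕ)
    (σ : K.Simplex p) : L.Simplex p :=
  ⟨σ.1, h σ.2.1, σ.2.2⟩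

/-- The map induced on `p`-chains by the inclusion of a subcomplex. -/
def chainMap {K L : PreAbstractSimplicialComplex V} (h : K ≤ L) (p : ℕ) :
    K.Chain p →ₗ[ZMod 2] L.Chain p :=
  Finsupp.lmapDomain (ZMod 2) (ZMod 2) (Simplex.incl h p)

theorem chainMap_comp_boundary {K L : PreAbstractSimplicialComplex V} (h : K ≤ L) (p : ℕ) :
    chainMap h p ∘ₗ K.boundary p = L.boundary p ∘ₗ chainMap h (p + 1) := by
  refine Finsupp.lhom_ext' fun σ => LinearMap.ext_ring ?_
  simp only [LinearMap.comp_apply, Finsupp.lsingle_apply, boundary, chainMap,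
    Finsupp.linearCombination_single, one_smul, map_sum, Finsupp.lmapDomain_apply,
    Finsupp.mapDomain_single]
  rfl

theorem range_boundary_le {K L : PreAbstractSimplicialComplex V} (h : K ≤ L) :
    LinearMap.range (K.boundary 0) ≤ (LinearMap.range (L.boundary 0)).comap (chainMap h 0) := by
  rintro _ ⟨z, rfl⟩
  exact ⟨chainMap h 1 z, (LinearMap.congr_fun (chainMap_comp_boundary h 0) z).symm⟩

/-- The map `H_0(K) → H_0(L)` induced by the inclusion of a subcomplex. -/
def H0map {K L : PreAbstractSimplicialComplex V} (h : K ≤ L) : K.H0 →ₗ[ZMod 2] L.H0 :=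
  Submodule.mapQ _ _ (chainMap h 0) (range_boundary_le h)

theorem H0map_id (K : PreAbstractSimplicialComplex V) : H0map (le_refl K) = LinearMap.id := by
  refine Submodule.linearMap_qext _ (LinearMap.ext fun z => ?_)
  have hz : chainMap (le_refl K) 0 z = z := by
    have : Simplex.incl (le_refl K) 0 = id := rfl
    simp [chainMap, this]
  simp [H0map, hz]

theorem H0map_comp {K L M : PreAbstractSimplicialComplex V} (h₁ : K ≤ L) (h₂ : L ≤ M) :
    H0map h₂ ∘ₗ H0map h₁ = H0map (h₁.trans h₂) := by
  refine Submodule.linearMap_qext _ (LinearMap.ext fun z => ?_)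
  have hz : chainMap h₂ 0 (chainMap h₁ 0 z) = chainMap (h₁.trans h₂) 0 z := by
    simp only [chainMap, Finsupp.lmapDomain_apply, ← Finsupp.mapDomain_comp]
    rfl
  simp [H0map, hz]

end PreAbstractSimplicialComplex

/-- The Čech complex of `X` at scale `s`: the nonempty finite `σ ⊆ X` such that the closed balls
of radius `s / 2` around the points of `σ` have a common point. It is empty for `s < 0`. -/
def cechComplex {E : Type u} [PseudoMetricSpace E] (X : Set E) (s : ℝ) :
    PreAbstractSimplicialComplex E where
  faces := {σ | σ.Nonempty ∧ ↑σ ⊆ X ∧ (⋂ x ∈ σ, Metric.closedBall x (s / 2)).Nonempty}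
  isRelLowerSet_faces := by
    rintro σ ⟨hne, hX, y, hy⟩
    refine ⟨hne, fun τ hτ hτne => ⟨hτne, ?_, y, ?_⟩⟩
    · exact fun x hx => hX (hτ hx)
    · simp only [Set.mem_iInter] at hy ⊢
      exact fun x hx => hy x (hτ hx)

theorem cechComplex_mono {E : Type u} [PseudoMetricSpace E] (X : Set E) {s t : ℝ} (h : s ≤ t) :
    cechComplex X s ≤ cechComplex X t := by
  rintro σ ⟨hne, hX, y, hy⟩
  refine ⟨hne, hX, y, ?_⟩
  simp only [Set.mem_iInter] at hy ⊢
  exact fun x hx => Metric.closedBall_subset_closedBall (by linarith) (hy x hx)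

/-! ### Persistence modules and landscapes -/

/-- A persistence module over `ℤ/2`, indexed by the real line. -/
structure PersistenceModule where
  V : ℝ → Type u
  [addCommGroup : ∀ t, AddCommGroup (V t)]
  [module : ∀ t, Module (ZMod 2) (V t)]
  map : ∀ {s t : ℝ}, s ≤ t → V s →ₗ[ZMod 2] V t
  map_id : ∀ t, map (le_refl t) = LinearMap.id
  map_comp : ∀ {r s t : ℝ} (h₁ : r ≤ s) (h₂ : s ≤ t), map h₂ ∘ₗ map h₁ = map (h₁.trans h₂)

attribute [instance] PersistenceModule.addCommGroup PersistenceModule.module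

namespace PersistenceModule

open Classical in
/-- The subspace of `V_t` that is killed by the truncation at time `T`. -/
def killed (M : PersistenceModule.{u}) (T t : ℝ) : Submodule (ZMod 2) (M.V t) :=
  if t < T then ⊥ else ⊤

theorem killed_le (M : PersistenceModule.{u}) (T : ℝ) {s t : ℝ} (h : s ≤ t) :
    M.killed T s ≤ (M.killed T t).comap (M.map h) := by
  unfold killed
  split_ifs with h₁ h₂
  · exact bot_le
  · exact bot_le
  · exact absurd (h.trans_lt ‹t < T›) h₁
  · simp

/-- The persistence module `M` with all classes dying at time `T` at the latest: it is `V_t` for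
`t < T` and `0` for `t ≥ T`. It turns an interval `[b, d)` with `b < T` into
`[b, min(d, T))`. -/
def truncate (M : PersistenceModule.{u}) (T : ℝ) : PersistenceModule.{u} where
  V t := M.V t ⧸ M.killed T t
  map h := Submodule.mapQ _ _ (M.map h) (M.killed_le T h)
  map_id t := by
    refine Submodule.linearMap_qext _ (LinearMap.ext fun z => ?_)
    simp [M.map_id]
  map_comp h₁ h₂ := by
    refine Submodule.linearMap_qext _ (LinearMap.ext fun z => ?_)
    simp [← M.map_comp h₁ h₂]

/-- The persistence landscape `f^(n)(t) = sup {m ≥ 0 : rank M^{t-m,t+m} ≥ n}`, `n ≥ 1`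
(the supremum is taken in `[0, ∞]`, so it is `0` over the empty set). -/
def landscape (M : PersistenceModule.{u}) (n : ℕ) (t : ℝ) : ℝ≥0∞ :=
  ⨆ (m : ℝ≥0)
    (_ : (n : Cardinal.{u}) ≤ (M.map (show t - m ≤ t + m by linarith [m.2])).rank), (m : ℝ≥0∞)

end PersistenceModule

/-- The persistence module `H_0` of the Čech filtration of `X`, over `ℤ/2`. -/
def cechH0 {E : Type u} [PseudoMetricSpace E] (X : Set E) : PersistenceModule.{u} where
  V t := (cechComplex X t).H0
  map h := PreAbstractSimplicialComplex.H0map (cechComplex_mono X h)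
  map_id _ := PreAbstractSimplicialComplex.H0map_id _
  map_comp _ _ := PreAbstractSimplicialComplex.H0map_comp _ _

/-- The persistence landscape of `H_0` of the Čech filtration of a bounded set `X`, with the
convention that the maximal death time (the death time of the class that survives at all
scales) is the diameter of `X`. -/
def cechH0Landscape {E : Type u} [PseudoMetricSpace E] (X : Set E) (n : ℕ) (t : ℝ) : ℝ≥0∞ :=
  ((cechH0 X).truncate (Metric.diam X)).landscape n t

/-- The hat function `τ_{(a,b)}(t) = max(0, min(t - a, b - t))`. -/
def hat (a b t : ℝ) : ℝ :=
  max 0 (min (t - a) (b - t))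

/-! ### The one-dimensional data -/

/-- The `(k + 1)`-st largest entry of the finite family `v`, counted with multiplicity
(`Tuple.sort v` sorts `v` in increasing order). -/
def kmax {n : ℕ} (v : Fin n → ℝ) (k : Fin n) : ℝ :=
  v (Tuple.sort v k.rev)

/-- The maps `ψ_j(x) = c (x + b_j)` of the real line. -/
def lineIFS {N : ℕ} (c : ℝ) (b : Fin N → ℝ) (j : Fin N) (x : ℝ) : ℝ :=
  c * (x + b j)

/-- The differences `a_j = b_{j+1} - b_j` of consecutive parameters. -/
def gap {n : ℕ} (b : Fin (n + 1) → ℝ) (j : Fin n) : ℝ :=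
  b j.succ - b j.castSucc

end

/-! The landscape is determined by counting components. On the line two closed balls of radius `s /
2` meet exactly when their centres are at distance at most `s`, so `H_0` at scale `s ≥ 0` is free on
the classes generated by steps of length at most `s`. No point enters after scale `0`, hence the
structure maps are onto. The rank from `u ≥ 0` to `v < diam A` is therefore the number of components
at scale `v`, and `f^(j)` is the hat on `(0, d)`, where `d` is the scale (at most `diam A`) at which
fewer than `j` components remain (`cechH0Landscape_eq_hat`).

Let `α`, `β` be the extreme points of `A`. They are the fixed points of the first and last maps, so
`β - α = δ 1 = diam A`. Each piece `ψ_j(A)` has diameter `c * (β - α)`, and consecutive pieces are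
separated by the signed length `c * (gap b l - (β - α))`. Condition (*) says that this length is at
least the diameter of a piece.

Under (*) there are two regimes. At scales `s ≥ c * (β - α)` each piece lies in one component, and
the count is one plus the number of gaps longer than `s`. At smaller scales different pieces do not
interact, and self-similarity gives count(s) = N * count(s / c) (`mk_scaleComponents_eq_mul`).
Induction on `k` then yields the thresholds `c ^ k * δ l` (`le_mk_scaleComponents_iff`). -/

namespace PreAbstractSimplicialComplex

variable {V : Type*}

/-! ### Degree-zero homology and connected components -/

/-- Two vertices of `K` are joined by an edge, or equal. -/
def EdgeRel (K : PreAbstractSimplicialComplex V) (v w : K.Simplex 0) : Prop :=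
  ∃ σ ∈ K.faces, v.1 ⊆ σ ∧ w.1 ⊆ σ

theorem Simplex.exists_eq_singleton {K : PreAbstractSimplicialComplex V} (v : K.Simplex 0) :
    ∃ x, v.1 = {x} :=
  Finset.card_eq_one.mp v.2.2

theorem boundary_single_pair (K : PreAbstractSimplicialComplex V) (σ : K.Simplex 1) :
    ∃ v w : K.Simplex 0, K.EdgeRel v w ∧
      K.boundary 0 (Finsupp.single σ 1) = Finsupp.single v 1 + Finsupp.single w 1 := by
  classical
  obtain ⟨a, b, hab, hσ⟩ := Finset.card_eq_two.mp σ.2.2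
  have ha : a ∈ σ.1 := by simp [hσ]
  have hb : b ∈ σ.1 := by simp [hσ]
  refine ⟨σ.face ⟨a, ha⟩, σ.face ⟨b, hb⟩,
    ⟨σ.1, σ.2.1, Finset.erase_subset _ _, Finset.erase_subset _ _⟩, ?_⟩
  have huniv : (Finset.univ : Finset {x // x ∈ σ.1}) = {⟨a, ha⟩, ⟨b, hb⟩} := by
    ext ⟨x, hx⟩
    rw [hσ] at hx
    simpa using hx
  rw [boundary, Finsupp.linearCombination_single, one_smul, huniv, Finset.sum_pair]
  simpa using hab

theorem EdgeRel.single_sub_single_mem {K : PreAbstractSimplicialComplex V} {v w : K.Simplex 0}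
    (h : K.EdgeRel v w) :
    (Finsupp.single v 1 - Finsupp.single w 1 : K.Chain 0) ∈ LinearMap.range (K.boundary 0) := by
  classical
  obtain ⟨ρ, hρ, hvρ, hwρ⟩ := h
  obtain ⟨a, ha⟩ := v.exists_eq_singleton
  obtain ⟨b, hb⟩ := w.exists_eq_singleton
  by_cases hab : a = b
  · have : v = w := Subtype.ext (by rw [ha, hb, hab])
    simp [this]
  -- The face `ρ` may have many vertices; closure under subsets supplies the edge itself.
  have hσ : ({a, b} : Finset V) ∈ K.faces := by
    refine (K.isRelLowerSet_faces hρ).2 ?_ (by simp)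
    intro x hx
    rcases Finset.mem_insert.mp hx with rfl | hx
    · exact hvρ (by simp [ha])
    · exact hwρ (by rwa [hb])
  let σ : K.Simplex 1 := ⟨{a, b}, hσ, Finset.card_pair hab⟩
  refine ⟨Finsupp.single σ 1, ?_⟩
  have huniv : (Finset.univ : Finset {x // x ∈ σ.1}) =
      {⟨a, by simp [σ]⟩, ⟨b, by simp [σ]⟩} := by
    ext ⟨x, hx⟩
    have hx' : x = a ∨ x = b := by simpa [σ] using hx
    rcases hx' with rfl | rfl <;> simp
  have h₁ : σ.face ⟨a, by simp [σ]⟩ = w := by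
    refine Subtype.ext ?_
    ext x
    simp only [Simplex.face, σ, hb, Finset.mem_erase, Finset.mem_insert, Finset.mem_singleton]
    grind
  have h₂ : σ.face ⟨b, by simp [σ]⟩ = v := by
    refine Subtype.ext ?_
    ext x
    simp only [Simplex.face, σ, ha, Finset.mem_erase, Finset.mem_insert, Finset.mem_singleton]
    grind
  rw [boundary, Finsupp.linearCombination_single, one_smul, huniv, Finset.sum_pair, h₁, h₂,
    sub_eq_add_neg, ← Finsupp.single_neg, ZMod.neg_eq_self_mod_two, add_comm]
  simpa using hab

/-- `H_0` is free on the set of connected components. -/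
noncomputable def h0Equiv (K : PreAbstractSimplicialComplex V) :
    K.H0 ≃ₗ[ZMod 2] (Quot K.EdgeRel →₀ ZMod 2) :=
  LinearEquiv.ofLinearMap
    -- Add up coefficients over each component. An edge has both ends in one component, so its
    -- boundary contributes `1 + 1 = 0`.
    (Submodule.liftQ _ (Finsupp.lmapDomain (ZMod 2) (ZMod 2) (Quot.mk K.EdgeRel)) (by
      rw [LinearMap.range_le_ker_iff]
      refine Finsupp.lhom_ext' fun σ => LinearMap.ext_ring ?_
      obtain ⟨v, w, hvw, h⟩ := K.boundary_single_pair σ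
      simp only [LinearMap.comp_apply, Finsupp.lsingle_apply, h, map_add,
        Finsupp.lmapDomain_apply, Finsupp.mapDomain_single, Quot.sound hvw,
        ← Finsupp.single_add, LinearMap.zero_apply]
      rw [CharTwo.add_self_eq_zero, Finsupp.single_zero]))
    -- The inverse picks any vertex of the component; joined vertices differ by a boundary.
    (Finsupp.linearCombination (ZMod 2) (Quot.lift
      (fun v => Submodule.Quotient.mk (p := LinearMap.range (K.boundary 0)) (Finsupp.single v 1))
      fun _ _ h => (Submodule.Quotient.eq _).mpr h.single_sub_single_mem))
    (by
      refine Finsupp.lhom_ext' fun q => LinearMap.ext_ring ?_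
      induction q using Quot.inductionOn
      simp)
    (by
      refine Submodule.linearMap_qext _ (Finsupp.lhom_ext' fun v => LinearMap.ext_ring ?_)
      simp)

theorem rank_h0 (K : PreAbstractSimplicialComplex V) :
    Module.rank (ZMod 2) K.H0 = Cardinal.mk (Quot K.EdgeRel) := by
  rw [K.h0Equiv.rank_eq, rank_finsupp_self, Cardinal.lift_uzero]

end PreAbstractSimplicialComplex

/-! ### Ranks in the Čech filtration -/

/-- The connected components of `X` at scale `s`: the classes of the equivalence relation
generated by `dist x y ≤ s`. -/
def ScaleComponents {E : Type*} [PseudoMetricSpace E] (X : Set E) (s : ℝ) : Type _ :=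
  Quot fun x y : X => dist x y ≤ s

section Cech

open PreAbstractSimplicialComplex

theorem singleton_mem_cechComplex {E : Type*} [PseudoMetricSpace E] {X : Set E} {s : ℝ}
    (hs : 0 ≤ s) {x : E} (hx : x ∈ X) : {x} ∈ (cechComplex X s).faces :=
  ⟨by simp, by simpa using hx, x, by simpa using by linarith⟩

/-- The vertices of the Čech complex at a nonnegative scale. -/
noncomputable def cechVertexEquiv {E : Type*} [PseudoMetricSpace E] (X : Set E) {s : ℝ}
    (hs : 0 ≤ s) : X ≃ (cechComplex X s).Simplex 0 :=
  Equiv.ofBijective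
    (fun x => ⟨{x.1}, singleton_mem_cechComplex hs x.2, by simp⟩) (by
      constructor
      · intro x y h
        have := congrArg Subtype.val h
        exact Subtype.ext (by simpa using this)
      · intro v
        obtain ⟨x, hx⟩ := v.exists_eq_singleton
        have hxX : x ∈ X := v.2.1.2.1 (by simp [hx])
        exact ⟨⟨x, hxX⟩, Subtype.ext hx.symm⟩)

/-- The midpoint of two real points lies in both balls; the converse is the triangle inequality
through a common point of the balls. -/
theorem edgeRel_cechVertexEquiv_iff {X : Set ℝ} {s : ℝ} (hs : 0 ≤ s) (x y : X) :
    dist x y ≤ s ↔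
      (cechComplex X s).EdgeRel (cechVertexEquiv X hs x) (cechVertexEquiv X hs y) := by
  classical
  constructor
  · intro h
    refine ⟨{x.1, y.1}, ⟨by simp, ?_, (x.1 + y.1) / 2, ?_⟩, ?_, ?_⟩
    · intro z hz
      simp only [Finset.coe_insert, Finset.coe_singleton, Set.mem_insert_iff,
        Set.mem_singleton_iff] at hz
      rcases hz with rfl | rfl
      exacts [x.2, y.2]
    · rw [Subtype.dist_eq, Real.dist_eq, abs_le] at h
      simp only [Set.mem_iInter, Finset.mem_insert, Finset.mem_singleton, Metric.mem_closedBall,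
        Real.dist_eq, abs_le]
      rintro z (rfl | rfl) <;> constructor <;> linarith [h.1, h.2]
    · change ({x.1} : Finset ℝ) ⊆ _
      simp
    · change ({y.1} : Finset ℝ) ⊆ _
      simp
  · rintro ⟨σ, ⟨-, -, z, hz⟩, hx, hy⟩
    simp only [Set.mem_iInter, Metric.mem_closedBall] at hz
    have h₁ := hz x.1 (hx (Finset.mem_singleton_self x.1))
    have h₂ := hz y.1 (hy (Finset.mem_singleton_self y.1))
    rw [Subtype.dist_eq]
    linarith [dist_triangle_left x.1 y.1 z]

theorem rank_cechComplex_h0 (X : Set ℝ) {s : ℝ} (hs : 0 ≤ s) :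
    Module.rank (ZMod 2) (cechComplex X s).H0 = Cardinal.mk (ScaleComponents X s) := by
  rw [rank_h0]
  exact (Cardinal.mk_congr
    (Quot.congr (cechVertexEquiv X hs) (edgeRel_cechVertexEquiv_iff hs))).symm

/-- Every point of `X` is already a vertex at scale `0`, so no class is born later. -/
theorem cechH0_map_surjective {E : Type*} [PseudoMetricSpace E] (X : Set E) {s t : ℝ}
    (hs : 0 ≤ s) (h : s ≤ t) : Function.Surjective ((cechH0 X).map h) := by
  have hincl : Function.Surjective (Simplex.incl (cechComplex_mono X h) 0) := by
    intro v
    obtain ⟨x, hx⟩ := v.exists_eq_singleton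
    have hxX : x ∈ X := v.2.1.2.1 (by simp [hx])
    exact ⟨⟨{x}, singleton_mem_cechComplex hs hxX, by simp⟩, Subtype.ext hx.symm⟩
  intro z
  obtain ⟨z, rfl⟩ := Submodule.Quotient.mk_surjective _ z
  obtain ⟨w, rfl⟩ := Finsupp.mapDomain_surjective hincl z
  exact ⟨Submodule.Quotient.mk w, rfl⟩

theorem subsingleton_cechComplex_h0 {E : Type*} [PseudoMetricSpace E] (X : Set E) {s : ℝ}
    (hs : s < 0) : Subsingleton (cechComplex X s).H0 := by
  have : IsEmpty ((cechComplex X s).Simplex 0) := by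
    refine ⟨fun v => ?_⟩
    obtain ⟨x, hx⟩ := v.exists_eq_singleton
    obtain ⟨y, hy⟩ := v.2.1.2.2
    simp only [Set.mem_iInter, Metric.mem_closedBall] at hy
    linarith [hy x (by simp [hx]), dist_nonneg (x := y) (y := x)]
  exact (Submodule.Quotient.mk_surjective _).subsingleton

/-- The ranks of the truncated persistence module of the Čech filtration. -/
theorem le_rank_cechH0_truncate_iff (X : Set ℝ) (T : ℝ) {s t : ℝ} (h : s ≤ t) {j : ℕ}
    (hj : 1 ≤ j) :
    (j : Cardinal) ≤ (((cechH0 X).truncate T).map h).rank ↔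
      0 ≤ s ∧ t < T ∧ (j : Cardinal) ≤ Cardinal.mk (ScaleComponents X t) := by
  have hzero : ∀ κ : Cardinal, κ = 0 → ¬ (j : Cardinal) ≤ κ := by
    rintro _ rfl h0
    have : j = 0 := by exact_mod_cast nonpos_iff_eq_zero.mp h0
    omega
  by_cases hs : 0 ≤ s
  swap
  · have h1 : Subsingleton ((cechH0 X).V s) := subsingleton_cechComplex_h0 X (lt_of_not_ge hs)
    have h2 : Subsingleton (((cechH0 X).truncate T).V s) :=
      (Submodule.Quotient.mk_surjective ((cechH0 X).killed T s)).subsingleton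
    refine iff_of_false (hzero _ ?_) fun h => hs h.1
    have : ((cechH0 X).truncate T).map h = 0 := LinearMap.ext fun x => by
      rw [Subsingleton.elim x 0, map_zero, map_zero]
    rw [this, LinearMap.rank_zero]
  by_cases ht : t < T
  swap
  · refine iff_of_false (hzero _ ?_) fun h => ht h.2.1
    have : ((cechH0 X).truncate T).map h = 0 := LinearMap.ext fun x => by
      have : Subsingleton (((cechH0 X).truncate T).V t) := by
        change Subsingleton ((cechH0 X).V t ⧸ (cechH0 X).killed T t)
        rw [PersistenceModule.killed, if_neg ht]
        infer_instance
      exact Subsingleton.elim _ _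
    rw [this, LinearMap.rank_zero]
  -- In the remaining range the map is onto and nothing has been killed, so its rank is the
  -- dimension of the target.
  have hsurj : Function.Surjective (((cechH0 X).truncate T).map h) := by
    intro z
    obtain ⟨z, rfl⟩ := Submodule.Quotient.mk_surjective _ z
    obtain ⟨w, rfl⟩ := cechH0_map_surjective X hs h z
    exact ⟨Submodule.Quotient.mk w, rfl⟩
  have hker : (cechH0 X).killed T t = ⊥ := by rw [PersistenceModule.killed, if_pos ht]
  have hrank : (((cechH0 X).truncate T).map h).rank = Cardinal.mk (ScaleComponents X t) := by
    rw [LinearMap.rank, LinearMap.range_eq_top.mpr hsurj, rank_top, ← rank_cechComplex_h0 X (hs.trans h)]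
    exact (Submodule.quotEquivOfEqBot _ hker).rank_eq
  rw [hrank]
  simp [hs, ht]

end Cech

/-! ### From component counts to hat functions -/

/-- The admissible `m` satisfy `m ≤ t` and `m < d - t`. Strictness at the open end does not affect
the supremum, and the empty supremum `0` matches the `max` with `0` in `hat`. -/
theorem iSup_nnreal_eq_ofReal_hat {d t : ℝ} {p : ℝ≥0 → Prop}
    (hp : ∀ m : ℝ≥0, p m ↔ 0 ≤ t - m ∧ t + m < d) :
    ⨆ (m : ℝ≥0) (_ : p m), (m : ℝ≥0∞) = ENNReal.ofReal (hat 0 d t) := by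
  apply le_antisymm
  · refine iSup₂_le fun m hm => ?_
    obtain ⟨h1, h2⟩ := (hp m).mp hm
    rw [← ENNReal.ofReal_coe_nnreal]
    refine ENNReal.ofReal_le_ofReal (le_max_of_le_right (le_min ?_ ?_)) <;> linarith
  · refine le_of_forall_lt fun a ha => ?_
    lift a to ℝ≥0 using ha.ne_top
    rw [← ENNReal.ofReal_coe_nnreal, ENNReal.ofReal_lt_ofReal_iff'] at ha
    obtain ⟨r, har, hr⟩ := exists_between ha.1
    have hr0 : 0 ≤ r := a.2.trans har.le
    rcases lt_max_iff.mp hr with h | h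
    · linarith
    obtain ⟨h1, h2⟩ := lt_min_iff.mp h
    refine lt_of_lt_of_le ?_ (le_iSup₂ (f := fun (m : ℝ≥0) (_ : p m) => (m : ℝ≥0∞))
      (⟨r, hr0⟩ : ℝ≥0) ((hp _).mpr ⟨?_, ?_⟩))
    · exact ENNReal.coe_lt_coe.mpr har
    · change 0 ≤ t - r
      linarith
    · change t + r < d
      linarith

/-- Reduces a landscape function to one threshold `d`. Only nonnegative scales need testing, because
`0 ≤ t - m` forces `0 ≤ t + m`. -/
theorem cechH0Landscape_eq_hat {X : Set ℝ} {j : ℕ} (hj : 1 ≤ j) {d : ℝ}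
    (hd : ∀ s, 0 ≤ s → (s < d ↔ s < Metric.diam X ∧
      (j : Cardinal) ≤ Cardinal.mk (ScaleComponents X s))) (t : ℝ) :
    cechH0Landscape X j t = ENNReal.ofReal (hat 0 d t) := by
  refine iSup_nnreal_eq_ofReal_hat fun m => ?_
  rw [le_rank_cechH0_truncate_iff _ _ _ hj]
  refine and_congr_right fun h => (hd _ ?_).symm
  linarith [m.2]

/-- The number of entries of `v` above `s` exceeds `k` iff the `(k + 1)`-st largest one does. -/
theorem lt_kmax_iff {n : ℕ} (v : Fin n → ℝ) (k : Fin n) (s : ℝ) :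
    s < kmax v k ↔ (k : ℕ) + 1 ≤ Fintype.card {i // s < v i} := by
  classical
  have hmono : Monotone (v ∘ Tuple.sort v) := Tuple.monotone_sort v
  have hcard : Fintype.card {i // s < v i} =
      (Finset.univ.filter fun i => s < v (Tuple.sort v i)).card := by
    rw [← Fintype.card_subtype]
    exact Fintype.card_congr ((Tuple.sort v).subtypeEquiv fun _ => Iff.rfl).symm
  have hk := k.2
  rw [hcard]
  constructor
  · intro h
    -- In increasing order, exactly `k + 1` positions are at or above `k.rev`, and `k` are strictly
    -- above it.
    have hsub : Finset.Ici k.rev ⊆ Finset.univ.filter fun i => s < v (Tuple.sort v i) := by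
      intro i hi
      simpa using lt_of_lt_of_le h (hmono (Finset.mem_Ici.mp hi))
    have := Finset.card_le_card hsub
    rw [Fin.card_Ici, Fin.val_rev] at this
    omega
  · intro h
    by_contra hs
    have hsub : (Finset.univ.filter fun i => s < v (Tuple.sort v i)) ⊆ Finset.Ioi k.rev := by
      intro i hi
      rw [Finset.mem_Ioi]
      by_contra hik
      exact hs (lt_of_lt_of_le (by simpa using hi) (hmono (not_lt.mp hik)))
    have := Finset.card_le_card hsub
    rw [Fin.card_Ioi, Fin.val_rev] at this
    omega

/-- A function that does not change along steps of length at most `s` is constant on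
components at scale `s`. -/
theorem ScaleComponents.apply_eq_of_mk_eq {E β : Type*} [PseudoMetricSpace E] {X : Set E} {s : ℝ}
    (f : X → β) (hf : ∀ x y : X, dist x y ≤ s → f x = f y) {x y : X}
    (h : Quot.mk (fun x y : X => dist x y ≤ s) x = Quot.mk _ y) : f x = f y :=
  congrArg (Quot.lift f hf) h

/-! ### Geometry of the invariant set and well-separated images -/

/-- The extreme points of the invariant set of the maps `c (x + b_j)`, for increasing `b`. -/
structure IsLineInvariant {n : ℕ} (c : ℝ) (b : Fin (n + 1) → ℝ) (A : Set ℝ) (α β : ℝ) :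
    Prop where
  pos : 0 < c
  lt_one : c < 1
  mono : Monotone b
  isLeast : IsLeast A α
  isGreatest : IsGreatest A β
  eq_iUnion : A = ⋃ j, lineIFS c b j '' A
  left_eq : α = c * (α + b 0)
  right_eq : β = c * (β + b (Fin.last n))

/-- As `c > 0`, the value `c * (x + b j)` is monotone in both `x` and `j`. Its minimum over the
pieces is thus attained at the least point and the first index, its maximum at the greatest point
and the last index. -/
theorem IsInvariantSet.exists_isLineInvariant {n : ℕ} {c : ℝ} (hc : c ∈ Set.Ioo (0 : ℝ) 1)
    {b : Fin (n + 1) → ℝ} (hb : Monotone b) {A : Set ℝ} (hA : IsInvariantSet (lineIFS c b) A) :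
    ∃ α β, IsLineInvariant c b A α β := by
  obtain ⟨hne, hcomp, hU⟩ := hA
  obtain ⟨α, hα⟩ := hcomp.exists_isLeast hne
  obtain ⟨β, hβ⟩ := hcomp.exists_isGreatest hne
  have hmem : ∀ j, ∀ x ∈ A, c * (x + b j) ∈ A := fun j x hx => by
    rw [hU]
    exact Set.mem_iUnion.mpr ⟨j, x, hx, rfl⟩
  refine ⟨α, β, hc.1, hc.2, hb, hα, hβ, hU, ?_, ?_⟩
  · refine le_antisymm (hα.2 (hmem 0 α hα.1)) ?_
    have h := hα.1
    rw [hU] at h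
    obtain ⟨j, x, hx, hxα⟩ := Set.mem_iUnion.mp h
    refine le_of_le_of_eq ?_ hxα
    exact mul_le_mul_of_nonneg_left (add_le_add (hα.2 hx) (hb (Fin.zero_le j))) hc.1.le
  · refine le_antisymm ?_ (hβ.2 (hmem (Fin.last n) β hβ.1))
    have h := hβ.1
    rw [hU] at h
    obtain ⟨j, x, hx, hxβ⟩ := Set.mem_iUnion.mp h
    refine le_of_eq_of_le hxβ.symm ?_
    exact mul_le_mul_of_nonneg_left (add_le_add (hβ.2 hx) (hb (Fin.le_last j))) hc.1.le

namespace IsLineInvariant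

variable {n : ℕ} {c : ℝ} {b : Fin (n + 1) → ℝ} {A : Set ℝ} {α β : ℝ}

theorem left_le_right (h : IsLineInvariant c b A α β) : α ≤ β := h.isLeast.2 h.isGreatest.1

theorem mem (h : IsLineInvariant c b A α β) (j : Fin (n + 1)) {x : ℝ} (hx : x ∈ A) :
    c * (x + b j) ∈ A := by
  rw [h.eq_iUnion]
  exact Set.mem_iUnion.mpr ⟨j, x, hx, rfl⟩

theorem exists_preimage (h : IsLineInvariant c b A α β) {x : ℝ} (hx : x ∈ A) :
    ∃ j, ∃ y ∈ A, x = c * (y + b j) := by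
  rw [h.eq_iUnion] at hx
  obtain ⟨j, y, hy, hxy⟩ := Set.mem_iUnion.mp hx
  exact ⟨j, y, hy, hxy.symm⟩

theorem right_sub_left (h : IsLineInvariant c b A α β) :
    β - α = c / (1 - c) * (b (Fin.last n) - b 0) := by
  have : 1 - c ≠ 0 := by linarith [h.lt_one]
  field_simp
  linear_combination h.right_eq - h.left_eq

theorem diam_eq (h : IsLineInvariant c b A α β) : Metric.diam A = β - α := by
  have hb : Bornology.IsBounded A := isBounded_iff_bddBelow_bddAbove.mpr
    ⟨⟨α, h.isLeast.2⟩, ⟨β, h.isGreatest.2⟩⟩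
  rw [Real.diam_eq hb, h.isGreatest.csSup_eq, h.isLeast.csInf_eq]

theorem gap_le_sub (h : IsLineInvariant c b A α β) {j k : Fin (n + 1)} (hjk : j < k) :
    ∃ l : Fin n, l.castSucc = j ∧ l.succ ≤ k ∧ gap b l ≤ b k - b j := by
  have hjn : (j : ℕ) < n := by
    have := k.2
    have : (j : ℕ) < k := hjk
    omega
  refine ⟨⟨j, hjn⟩, rfl, ?_, ?_⟩
  · exact hjk
  · have h1 : b (Fin.succ ⟨j, hjn⟩) ≤ b k := h.mono hjk
    change b (Fin.succ ⟨j, hjn⟩) - b j ≤ _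
    linarith

/-- Points of different pieces are at distance at least the smallest gap. -/
theorem le_dist_of_ne (h : IsLineInvariant c b A α β)
    (hsep : ∀ l : Fin n, 2 * (β - α) ≤ gap b l) {j k : Fin (n + 1)} (hjk : j ≠ k) {x y : ℝ}
    (hx : x ∈ A) (hy : y ∈ A) : c * (β - α) ≤ dist (c * (x + b j)) (c * (y + b k)) := by
  wlog hlt : j < k generalizing j k x y
  · rw [dist_comm]
    exact this hjk.symm hy hx (lt_of_le_of_ne (not_lt.mp hlt) hjk.symm)
  obtain ⟨l, -, -, hl⟩ := h.gap_le_sub hlt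
  have h1 := hsep l
  have h2 := h.isGreatest.2 hx
  have h3 := h.isLeast.2 hy
  rw [dist_comm, Real.dist_eq]
  refine le_trans ?_ (le_abs_self _)
  rw [← mul_sub]
  exact mul_le_mul_of_nonneg_left (by linarith) h.pos.le

/-- All pieces are translates of `c • A`, so only distances matter. Without (*) consecutive pieces
might overlap or interleave, so the forward direction tests suitable pairs of points instead of
comparing endpoints of hulls. -/
theorem wellSeparatedImages_iff (h : IsLineInvariant c b A α β) :
    WellSeparatedImages (lineIFS c b) A ↔ ∀ l : Fin n, 2 * (β - α) ≤ gap b l := by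
  have hc := h.pos
  have hdist : ∀ (j : Fin (n + 1)) (x y : ℝ),
      edist (lineIFS c b j x) (lineIFS c b j y) = ENNReal.ofReal (c * |x - y|) := by
    intro j x y
    rw [edist_dist, Real.dist_eq, lineIFS, lineIFS, ← mul_sub, abs_mul, abs_of_pos hc,
      add_sub_add_right_eq_sub]
  simp only [WellSeparatedImages, setEDist, iSup_le_iff, le_iInf_iff, Set.forall_mem_image]
  constructor
  · intro H l
    have hgap : 0 ≤ gap b l := sub_nonneg.mpr (h.mono (Fin.castSucc_lt_succ).le)
    have hne : l.castSucc ≠ l.succ := (Fin.castSucc_lt_succ).ne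
    have hdiam : ENNReal.ofReal (c * (β - α)) ≤ Metric.ediam (lineIFS c b 0 '' A) := by
      have := Metric.edist_le_ediam_of_mem (Set.mem_image_of_mem (lineIFS c b 0) h.isGreatest.1)
        (Set.mem_image_of_mem (lineIFS c b 0) h.isLeast.1)
      rwa [hdist, abs_of_nonneg (sub_nonneg.mpr h.left_le_right)] at this
    have key : ∀ x ∈ A, ∀ y ∈ A, β - α ≤ |x - y - gap b l| := by
      intro x hx y hy
      have := hdiam.trans (H l.castSucc l.succ hne hx hy 0)
      rw [edist_dist, ENNReal.ofReal_le_ofReal_iff dist_nonneg, Real.dist_eq, lineIFS, lineIFS,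
        ← mul_sub, abs_mul, abs_of_pos hc, mul_le_mul_iff_right₀ hc] at this
      have e : x - y - gap b l = x + b l.castSucc - (y + b l.succ) := by
        rw [gap]
        ring
      rwa [e]
    have hle := h.left_le_right
    -- Facing endpoints give either the desired bound or `gap b l ≤ 0`. In the latter case the gap
    -- is zero, and comparing `α` with itself forces `β = α`, so the bound is trivial.
    rcases le_abs'.mp (key β h.isGreatest.1 α h.isLeast.1) with h1 | h1
    · linarith
    · have h2 := key α h.isLeast.1 α h.isLeast.1
      rw [sub_self, zero_sub, abs_neg, abs_of_nonneg hgap] at h2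
      linarith
  · intro H j k hjk x hx y hy i
    refine le_trans (Metric.ediam_le ?_) (b := ENNReal.ofReal (c * (β - α))) ?_
    · rintro _ ⟨u, hu, rfl⟩ _ ⟨v, hv, rfl⟩
      rw [hdist]
      refine ENNReal.ofReal_le_ofReal (mul_le_mul_of_nonneg_left ?_ hc.le)
      have := h.isLeast.2 hu
      have := h.isLeast.2 hv
      have := h.isGreatest.2 hu
      have := h.isGreatest.2 hv
      rw [abs_le]
      constructor <;> linarith
    · rw [edist_dist]
      exact ENNReal.ofReal_le_ofReal (h.le_dist_of_ne H hjk hx hy)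

/-! ### Counting components at small and large scales -/

/-- Below the smallest gap, the components are those of the `n + 1` scaled copies. -/
theorem mk_scaleComponents_eq_mul (h : IsLineInvariant c b A α β)
    (hsep : ∀ l : Fin n, 2 * (β - α) ≤ gap b l) {s : ℝ} (hs : s < c * (β - α)) (hs0 : 0 ≤ s) :
    Cardinal.mk (ScaleComponents A s) =
      ((n + 1 : ℕ) : Cardinal) * Cardinal.mk (ScaleComponents A (s / c)) := by
  have hc := h.pos
  let f : Fin (n + 1) × A → A := fun p => ⟨c * (p.2 + b p.1), h.mem p.1 p.2.2⟩
  have hne : ∀ p q : Fin (n + 1) × A, p.1 ≠ q.1 → s < dist (f p) (f q) := fun p q hpq =>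
    hs.trans_le (h.le_dist_of_ne hsep hpq p.2.2 q.2.2)
  have heq : ∀ p q : Fin (n + 1) × A, p.1 = q.1 → dist (f p) (f q) = c * dist p.2 q.2 := by
    rintro ⟨j, x⟩ ⟨k, y⟩ (rfl : j = k)
    simp only [f, Subtype.dist_eq, Real.dist_eq]
    rw [← mul_sub, abs_mul, abs_of_pos hc, add_sub_add_right_eq_sub]
  -- Points of different pieces are more than `s ≥ 0` apart, so the pieces are disjoint and each
  -- point of `A` has a unique address.
  have hf : Function.Bijective f := by
    constructor
    · intro p q hpq
      have h1 : p.1 = q.1 := by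
        by_contra hpq'
        have := hne p q hpq'
        rw [hpq, dist_self] at this
        linarith
      have h2 := heq p q h1
      rw [hpq, dist_self, eq_comm, mul_eq_zero, or_iff_right hc.ne', dist_eq_zero] at h2
      exact Prod.ext h1 h2
    · rintro ⟨x, hx⟩
      obtain ⟨j, y, hy, rfl⟩ := h.exists_preimage hx
      exact ⟨(j, ⟨y, hy⟩), rfl⟩
  -- The step relation pulled back along `f`: steps stay inside a piece, where lengths are scaled by
  -- `c`.
  let r : Fin (n + 1) × A → Fin (n + 1) × A → Prop :=
    fun p q => p.1 = q.1 ∧ dist p.2 q.2 ≤ s / c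
  have hr : ∀ p q, r p q ↔ dist (f p) (f q) ≤ s := by
    intro p q
    by_cases hpq : p.1 = q.1
    · rw [heq p q hpq, le_div_iff₀' hc |>.symm]
      exact and_iff_right hpq
    · exact iff_of_false (fun h => hpq h.1) (not_le.mpr (hne p q hpq))
  let e₁ : Quot r ≃ ScaleComponents A s := Quot.congr (Equiv.ofBijective f hf) hr
  let e₂ : Quot r ≃ Fin (n + 1) × ScaleComponents A (s / c) :=
    { toFun := Quot.lift (fun p => (p.1, Quot.mk _ p.2)) fun p q hpq =>
        Prod.ext hpq.1 (Quot.sound hpq.2)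
      invFun := fun p => Quot.lift (fun x => Quot.mk r (p.1, x))
        (fun x y hxy => Quot.sound ⟨rfl, hxy⟩) p.2
      left_inv := fun q => by
        induction q using Quot.inductionOn
        rfl
      right_inv := fun ⟨j, q⟩ => by
        induction q using Quot.inductionOn
        rfl }
  rw [← Cardinal.mk_congr e₁, Cardinal.mk_congr e₂, Cardinal.mk_prod]
  simp

/-- The left endpoints of the first piece and of the pieces to the right of a gap above `s`. -/
def gapPoint (h : IsLineInvariant c b A α β) (s : ℝ) :
    Option {l : Fin n // s < c * (gap b l - (β - α))} → A
  | none => ⟨c * (α + b 0), h.mem 0 h.isLeast.1⟩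
  | some l => ⟨c * (α + b l.1.succ), h.mem l.1.succ h.isLeast.1⟩

/-- Steps of length at most `s` do not cross a gap longer than `s`. -/
theorem le_iff_le_of_dist_le (h : IsLineInvariant c b A α β) {s : ℝ} {l : Fin n}
    (hl : s < c * (gap b l - (β - α))) (x y : A) (hxy : dist x y ≤ s) :
    x.1 ≤ c * (β + b l.castSucc) ↔ y.1 ≤ c * (β + b l.castSucc) := by
  have hc := h.pos
  have key : ∀ x : ℝ, x ∈ A → x ≤ c * (β + b l.castSucc) ∨ c * (α + b l.succ) ≤ x := by
    intro x hx
    obtain ⟨j, y, hy, rfl⟩ := h.exists_preimage hx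
    rcases le_or_gt j l.castSucc with hj | hj
    · left
      exact mul_le_mul_of_nonneg_left (add_le_add (h.isGreatest.2 hy) (h.mono hj)) hc.le
    · right
      exact mul_le_mul_of_nonneg_left
        (add_le_add (h.isLeast.2 hy) (h.mono (Fin.castSucc_lt_iff_succ_le.mp hj))) hc.le
  have hg : c * (gap b l - (β - α)) = c * (α + b l.succ) - c * (β + b l.castSucc) := by
    rw [gap]
    ring
  rw [Subtype.dist_eq, Real.dist_eq, abs_le] at hxy
  constructor
  · intro hx
    refine (key y y.2).resolve_right fun hy => ?_
    linarith [hxy.1]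
  · intro hy
    refine (key x x.2).resolve_right fun hx => ?_
    linarith [hxy.2]

/-- Being left of a gap longer than `s` is constant on components. For two listed points, the gap
belonging to the one further right separates them; `none` lies left of every such gap. -/
theorem injective_mk_gapPoint (h : IsLineInvariant c b A α β) {s : ℝ} (hs : 0 ≤ s) :
    Function.Injective fun o => (Quot.mk _ (h.gapPoint s o) : ScaleComponents A s) := by
  have hc := h.pos
  have hpos : ∀ l : {l : Fin n // s < c * (gap b l - (β - α))},
      c * (β + b l.1.castSucc) < c * (α + b l.1.succ) := by
    intro l
    have := l.2
    rw [gap] at this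
    linarith
  have key : ∀ (o : Option {l : Fin n // s < c * (gap b l - (β - α))}) l,
      (h.gapPoint s o).1 ≤ c * (β + b l.1.castSucc) →
      (Quot.mk _ (h.gapPoint s o) : ScaleComponents A s) ≠ Quot.mk _ (h.gapPoint s (some l)) := by
    intro o l ho heq
    have := ScaleComponents.apply_eq_of_mk_eq (fun x : A => x.1 ≤ c * (β + b l.1.castSucc))
      (fun x y hxy => propext (h.le_iff_le_of_dist_le l.2 x y hxy)) heq
    exact not_le.mpr (hpos l) (this.mp ho)
  have hle : ∀ j k, j ≤ k → c * (α + b j) ≤ c * (β + b k) := fun j k hjk =>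
    mul_le_mul_of_nonneg_left (add_le_add h.left_le_right (h.mono hjk)) hc.le
  have hlt : ∀ l m : {l : Fin n // s < c * (gap b l - (β - α))}, l.1 < m.1 →
      (Quot.mk _ (h.gapPoint s (some l)) : ScaleComponents A s) ≠
        Quot.mk _ (h.gapPoint s (some m)) := fun l m hlm =>
    key _ _ (hle _ _ (Fin.succ_le_castSucc_iff.mpr hlm))
  rintro (_ | l) (_ | m) heq
  · rfl
  · exact absurd heq (key _ _ (hle _ _ (Fin.zero_le _)))
  · exact absurd heq.symm (key _ _ (hle _ _ (Fin.zero_le _)))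
  · rcases lt_trichotomy l.1 m.1 with hlm | hlm | hlm
    · exact absurd heq (hlt l m hlm)
    · rw [Subtype.ext hlm]
    · exact absurd heq.symm (hlt m l hlm)

/-- Each piece has diameter at most `s`, hence lies in one component. Moving left from any piece
across gaps of length at most `s` stays in that component until a listed point is reached. -/
theorem surjective_mk_gapPoint (h : IsLineInvariant c b A α β)
    (hsep : ∀ l : Fin n, 2 * (β - α) ≤ gap b l) {s : ℝ} (hs : c * (β - α) ≤ s) :
    Function.Surjective fun o => (Quot.mk _ (h.gapPoint s o) : ScaleComponents A s) := by
  have hc := h.pos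
  have hle := h.left_le_right
  have hpiece : ∀ j, ∀ x (hx : x ∈ A), ∀ y (hy : y ∈ A),
      (Quot.mk _ ⟨c * (x + b j), h.mem j hx⟩ : ScaleComponents A s) =
        Quot.mk _ ⟨c * (y + b j), h.mem j hy⟩ := by
    intro j x hx y hy
    refine Quot.sound (le_trans ?_ hs)
    rw [Subtype.dist_eq, Real.dist_eq, ← mul_sub, abs_mul, abs_of_pos hc]
    refine mul_le_mul_of_nonneg_left ?_ hc.le
    have := h.isLeast.2 hx
    have := h.isLeast.2 hy
    have := h.isGreatest.2 hx
    have := h.isGreatest.2 hy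
    rw [abs_le]
    constructor <;> linarith
  have hleft : ∀ j, ∃ o, (Quot.mk _ (h.gapPoint s o) : ScaleComponents A s) =
      Quot.mk _ ⟨c * (α + b j), h.mem j h.isLeast.1⟩ := by
    intro j
    induction j using Fin.induction with
    | zero => exact ⟨none, rfl⟩
    | succ l ih =>
      by_cases hl : s < c * (gap b l - (β - α))
      · exact ⟨some ⟨l, hl⟩, rfl⟩
      · obtain ⟨o, ho⟩ := ih
        refine ⟨o, ho.trans ((hpiece _ α h.isLeast.1 β h.isGreatest.1).trans (Quot.sound ?_))⟩
        rw [Subtype.dist_eq, dist_comm, Real.dist_eq, ← mul_sub,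
          show α + b l.succ - (β + b l.castSucc) = gap b l - (β - α) by rw [gap]; ring,
          abs_of_nonneg (mul_nonneg hc.le (by linarith [hsep l]))]
        exact not_lt.mp hl
  intro q
  induction q using Quot.inductionOn with
  | h x =>
    obtain ⟨x, hx⟩ := x
    obtain ⟨j, y, hy, rfl⟩ := h.exists_preimage hx
    obtain ⟨o, ho⟩ := hleft j
    exact ⟨o, ho.trans (hpiece j α h.isLeast.1 y hy)⟩

theorem card_add_one_le_mk_scaleComponents (h : IsLineInvariant c b A α β) {s : ℝ} (hs : 0 ≤ s) :
    ((Fintype.card {l : Fin n // s < c * (gap b l - (β - α))} + 1 : ℕ) : Cardinal) ≤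
      Cardinal.mk (ScaleComponents A s) := by
  rw [← Fintype.card_option, ← Cardinal.mk_fintype]
  exact Cardinal.mk_le_of_injective (h.injective_mk_gapPoint hs)

theorem mk_scaleComponents_le_card_add_one (h : IsLineInvariant c b A α β)
    (hsep : ∀ l : Fin n, 2 * (β - α) ≤ gap b l) {s : ℝ} (hs : c * (β - α) ≤ s) :
    Cardinal.mk (ScaleComponents A s) ≤
      ((Fintype.card {l : Fin n // s < c * (gap b l - (β - α))} + 1 : ℕ) : Cardinal) := by
  rw [← Fintype.card_option, ← Cardinal.mk_fintype]
  exact Cardinal.mk_le_of_surjective (h.surjective_mk_gapPoint hsep hs)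

end IsLineInvariant

theorem exists_kmax_eq {n : ℕ} (v : Fin n → ℝ) (k : Fin n) : ∃ l, kmax v k = v l :=
  ⟨_, rfl⟩

namespace IsLineInvariant

variable {n : ℕ} {c : ℝ} {b : Fin (n + 1) → ℝ} {A : Set ℝ} {α β : ℝ}

/-! ### Thresholds for the number of components -/

/-- At any scale at least the largest diameter of a piece there are at most `n + 1` components. -/
theorem mk_scaleComponents_le (h : IsLineInvariant c b A α β)
    (hsep : ∀ l : Fin n, 2 * (β - α) ≤ gap b l) {s : ℝ} (hs : c * (β - α) ≤ s) :
    Cardinal.mk (ScaleComponents A s) ≤ ((n + 1 : ℕ) : Cardinal) := by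
  refine (h.mk_scaleComponents_le_card_add_one hsep hs).trans ?_
  have : Fintype.card {l : Fin n // s < c * (gap b l - (β - α))} ≤ n := by
    simpa using Fintype.card_subtype_le fun l : Fin n => s < c * (gap b l - (β - α))
  exact_mod_cast Nat.succ_le_succ this

/-- There are at least `k + 2` components, `k < n`, iff the `(k + 1)`-st largest gap is not yet
filled. -/
theorem le_mk_scaleComponents_iff_lt_kmax (h : IsLineInvariant c b A α β)
    (hsep : ∀ l : Fin n, 2 * (β - α) ≤ gap b l) (k : Fin n) {s : ℝ} (hs : 0 ≤ s) :
    ((k + 2 : ℕ) : Cardinal) ≤ Cardinal.mk (ScaleComponents A s) ↔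
      s < kmax (fun l => c * (gap b l - (β - α))) k := by
  rw [lt_kmax_iff]
  constructor
  · intro H
    rcases le_or_gt (c * (β - α)) s with hcs | hcs
    · have := H.trans (h.mk_scaleComponents_le_card_add_one hsep hcs)
      have := Nat.cast_le.mp this
      omega
    -- Below the diameter of a piece all `n` gaps are still open, so the claim holds whatever the
    -- component count.
    · have hall : ∀ l : Fin n, s < c * (gap b l - (β - α)) := fun l =>
        hcs.trans_le (mul_le_mul_of_nonneg_left (by linarith [hsep l]) h.pos.le)
      rw [Fintype.card_congr (Equiv.subtypeUnivEquiv hall), Fintype.card_fin]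
      exact k.2
  · intro H
    refine le_trans ?_ (h.card_add_one_le_mk_scaleComponents hs)
    exact_mod_cast Nat.succ_le_succ H

theorem le_kmax (h : IsLineInvariant c b A α β)
    (hsep : ∀ l : Fin n, 2 * (β - α) ≤ gap b l) (k : Fin n) :
    c * (β - α) ≤ kmax (fun l => c * (gap b l - (β - α))) k := by
  obtain ⟨l, hl⟩ := exists_kmax_eq (fun l => c * (gap b l - (β - α))) k
  rw [hl]
  exact mul_le_mul_of_nonneg_left (by linarith [hsep l]) h.pos.le

/-- Each gap length is a difference of two points of `A`, so it is at most the diameter. -/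
theorem kmax_le (h : IsLineInvariant c b A α β) (k : Fin n) :
    kmax (fun l => c * (gap b l - (β - α))) k ≤ β - α := by
  obtain ⟨l, hl⟩ := exists_kmax_eq (fun l => c * (gap b l - (β - α))) k
  rw [hl]
  have h1 := h.isGreatest.2 (h.mem l.succ h.isLeast.1)
  have h2 := h.isLeast.2 (h.mem l.castSucc h.isGreatest.1)
  simp only [gap]
  linarith

/-- The component counts at all scales. -/
theorem le_mk_scaleComponents_iff (h : IsLineInvariant c b A α β)
    (hsep : ∀ l : Fin n, 2 * (β - α) ≤ gap b l) (l : Fin n) (k : ℕ) :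
    ∀ (j : ℕ), (l + 1) * (n + 1) ^ k < j → j ≤ (l + 2) * (n + 1) ^ k → ∀ s : ℝ, 0 ≤ s →
      ((j : Cardinal) ≤ Cardinal.mk (ScaleComponents A s) ↔
        s < c ^ k * kmax (fun l => c * (gap b l - (β - α))) l) := by
  have hc := h.pos
  have hle := h.left_le_right
  induction k with
  | zero =>
    intro j hj1 hj2 s hs
    obtain rfl : j = l + 2 := by
      simp only [pow_zero, mul_one] at hj1 hj2
      omega
    rw [h.le_mk_scaleComponents_iff_lt_kmax hsep l hs, pow_zero, one_mul]
  | succ k ih =>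
    intro j hj1 hj2 s hs
    rcases lt_or_ge s (c * (β - α)) with hcs | hcs
    -- `i` is `j / (n + 1)` rounded up: `n + 1` copies of `m` components give at least `j` iff `i ≤
    -- m`, and the range for `j` at level `k + 1` becomes the range for `i` at level `k`.
    · obtain ⟨i, hi1, hi2⟩ : ∃ i, j ≤ (n + 1) * i ∧ (n + 1) * i < j + (n + 1) := by
        refine ⟨(j + n) / (n + 1), ?_, ?_⟩
        · have := Nat.lt_mul_div_succ (j + n) (Nat.succ_pos n)
          simp only [Nat.succ_eq_add_one, mul_add, mul_one] at this
          linarith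
        · have := Nat.mul_div_le (j + n) (n + 1)
          omega
      have hi3 : (l + 1) * (n + 1) ^ k < i := by
        have : (n + 1) * ((l + 1) * (n + 1) ^ k) < (n + 1) * i := by
          refine lt_of_le_of_lt (le_of_eq ?_) (hj1.trans_le hi1)
          ring
        exact lt_of_mul_lt_mul_left this (Nat.zero_le _)
      have hi4 : i ≤ (l + 2) * (n + 1) ^ k := by
        have : (n + 1) * i < (n + 1) * ((l + 2) * (n + 1) ^ k + 1) := by
          refine lt_of_lt_of_le hi2 ?_
          rw [mul_add, mul_one]
          refine Nat.add_le_add_right (hj2.trans (le_of_eq ?_)) _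
          ring
        exact Nat.lt_succ_iff.mp (lt_of_mul_lt_mul_left this (Nat.zero_le _))
      have hmul : (j : Cardinal) ≤ ((n + 1 : ℕ) : Cardinal) *
          Cardinal.mk (ScaleComponents A (s / c)) ↔
          (i : Cardinal) ≤ Cardinal.mk (ScaleComponents A (s / c)) := by
        -- The count may be infinite, as at scale `0`, where components are points; both sides then
        -- hold.
        rcases lt_or_ge (Cardinal.mk (ScaleComponents A (s / c))) Cardinal.aleph0 with hκ | hκ
        · obtain ⟨m, hm⟩ := Cardinal.lt_aleph0.mp hκ
          rw [hm]
          norm_cast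
          constructor
          · intro hjm
            have : (n + 1) * i < (n + 1) * (m + 1) := by
              rw [mul_add, mul_one]
              omega
            exact Nat.lt_succ_iff.mp (lt_of_mul_lt_mul_left this (Nat.zero_le _))
          · intro him
            exact hi1.trans (Nat.mul_le_mul_left _ him)
        · refine iff_of_true ?_ ((Cardinal.natCast_lt_aleph0).le.trans hκ)
          refine ((Cardinal.natCast_lt_aleph0).le.trans hκ).trans ?_
          exact Cardinal.le_mul_left (by simp)
      rw [h.mk_scaleComponents_eq_mul hsep hcs hs, hmul,
        ih i hi3 hi4 (s / c) (div_nonneg hs hc.le), div_lt_iff₀' hc, pow_succ', mul_assoc]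
    -- Both sides fail: at most `n + 1 < j` components remain, and the threshold, carrying at least
    -- one factor `c`, is at most `c * (β - α) ≤ s`.
    · refine iff_of_false (fun H => ?_) (not_lt.mpr ?_)
      · have := H.trans (h.mk_scaleComponents_le hsep hcs)
        have h1 : j ≤ n + 1 := by exact_mod_cast this
        have h2 : n + 1 ≤ (n + 1) ^ (k + 1) := Nat.le_self_pow (Nat.succ_ne_zero k) _
        have h3 : (n + 1) ^ (k + 1) ≤ (l + 1) * (n + 1) ^ (k + 1) :=
          Nat.le_mul_of_pos_left _ (Nat.succ_pos _)
        omega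
      · refine le_trans ?_ hcs
        rw [pow_succ', mul_assoc]
        refine mul_le_mul_of_nonneg_left ?_ hc.le
        have h1 := h.kmax_le l
        have h2 := h.le_kmax hsep l
        exact (mul_le_of_le_one_left ((mul_nonneg hc.le (sub_nonneg.mpr hle)).trans h2)
          (pow_le_one₀ hc.le h.lt_one.le)).trans h1

/-! ### The landscape functions -/

/-- There is always at least one component, so only the truncation at the diameter ends this class.
-/
theorem cechH0Landscape_one (h : IsLineInvariant c b A α β) (t : ℝ) :
    cechH0Landscape A 1 t = ENNReal.ofReal (hat 0 (β - α) t) := by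
  refine cechH0Landscape_eq_hat le_rfl (fun s _ => ?_) t
  rw [h.diam_eq]
  refine (and_iff_left ?_).symm
  have : Nonempty (ScaleComponents A s) := ⟨Quot.mk _ ⟨α, h.isLeast.1⟩⟩
  rw [Nat.cast_one, Cardinal.one_le_iff_ne_zero]
  exact Cardinal.mk_ne_zero _

/-- The truncation has no effect here, since these thresholds never exceed the diameter. The index
`l : Fin n` stands for `δ (l + 2)`. -/
theorem cechH0Landscape_eq (h : IsLineInvariant c b A α β)
    (hsep : ∀ l : Fin n, 2 * (β - α) ≤ gap b l) (l : Fin n) (k j : ℕ)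
    (hj₁ : (l + 1) * (n + 1) ^ k < j) (hj₂ : j ≤ (l + 2) * (n + 1) ^ k) (t : ℝ) :
    cechH0Landscape A j t =
      ENNReal.ofReal (hat 0 (c ^ k * kmax (fun l => c * (gap b l - (β - α))) l) t) := by
  refine cechH0Landscape_eq_hat (by omega) (fun s hs => ?_) t
  rw [h.le_mk_scaleComponents_iff hsep l k j hj₁ hj₂ s hs, h.diam_eq]
  refine (and_iff_right_of_imp fun H => H.trans_le ?_).symm
  refine (mul_le_of_le_one_left ?_ (pow_le_one₀ h.pos.le h.lt_one.le)).trans (h.kmax_le l)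
  exact (mul_nonneg h.pos.le (sub_nonneg.mpr h.left_le_right)).trans (h.le_kmax hsep l)

end IsLineInvariant

/-- There are `N = n + 1` maps, with parameters `b 0 ≤ b 1 ≤ … ≤ b n`. The numbers
`δ 1, …, δ N` are indexed from `1`, and so are the functions of the landscape. -/
theorem mainTheorem4 (n N : ℕ) (hN : N = n + 1) (c : ℝ) (hc : c ∈ Set.Ioo (0 : ℝ) 1)
    (b : Fin (n + 1) → ℝ) (hb : Monotone b)
    (A : Set ℝ) (hA : IsInvariantSet (lineIFS c b) A)
    (δ : ℕ → ℝ) (hδ₁ : δ 1 = c / (1 - c) * (b (Fin.last n) - b 0))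
    (hδ : ∀ k : Fin n, δ (k + 2) = kmax (fun l : Fin n => c * (gap b l - δ 1)) k) :
    (WellSeparatedImages (lineIFS c b) A ↔
      ∀ j : Fin n, 2 * c / (1 - c) * (b (Fin.last n) - b 0) ≤ gap b j) ∧
    ((∀ j : Fin n, 2 * c / (1 - c) * (b (Fin.last n) - b 0) ≤ gap b j) →
      (∀ j : ℕ, 1 ≤ j → j ≤ N → ∀ t : ℝ,
        cechH0Landscape A j t = ENNReal.ofReal (hat 0 (δ j) t)) ∧
      (∀ k l j : ℕ, 1 ≤ k → 2 ≤ l → l ≤ N → (l - 1) * N ^ k < j → j ≤ l * N ^ k → ∀ t : ℝ,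
        cechH0Landscape A j t = ENNReal.ofReal (hat 0 (c ^ k * δ l) t))) := by
  subst hN
  obtain ⟨α, β, h⟩ := hA.exists_isLineInvariant hc hb
  have hδ₁' : δ 1 = β - α := hδ₁.trans h.right_sub_left.symm
  have h2 : 2 * c / (1 - c) * (b (Fin.last n) - b 0) = 2 * (β - α) := by
    rw [h.right_sub_left]
    ring
  rw [hδ₁'] at hδ
  rw [h2]
  refine ⟨h.wellSeparatedImages_iff, fun hsep => ?_⟩
  -- Allowing `k = 0` also covers `2 ≤ j ≤ N`, with `l = j`.
  have main : ∀ k l j : ℕ, 2 ≤ l → l ≤ n + 1 → (l - 1) * (n + 1) ^ k < j →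
      j ≤ l * (n + 1) ^ k → ∀ t : ℝ,
      cechH0Landscape A j t = ENNReal.ofReal (hat 0 (c ^ k * δ l) t) := by
    intro k l j hl hln hj₁ hj₂ t
    obtain ⟨i, rfl⟩ := Nat.exists_eq_add_of_le' hl
    have := hδ ⟨i, by omega⟩
    simp only at this
    rw [this]
    exact h.cechH0Landscape_eq hsep ⟨i, by omega⟩ k j hj₁ hj₂ t
  refine ⟨fun j hj hjN t => ?_, fun k l j _ => main k l j⟩
  rcases hj.eq_or_lt with rfl | hj
  · rw [hδ₁']
    exact h.cechH0Landscape_one t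
  · have := main 0 j j hj hjN (by simp only [pow_zero, mul_one]; omega) (by simp) t
    rwa [pow_zero, one_mul] at this
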